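/- Let $n\ge 0$ and let $\nu_1,\dots,\nu_d\in\mathbb Z^{n+1}$, $d\ge n+1$, be a minimal set of primitive vectors defining a good cone \[ C=\bigcap_{j=1}^d\{x\in\mathbb R^{n+1}:\ \ell_j(x):=\langle x,\nu_j\rangle\ge 0\}, \] i.e. no inequality is redundant and, for $1\le k\le n$, every codimension-$k$ face of $C$ lies on exactly $k$ of the facets $C\cap\{\ell_j=0\}$, is their intersection, and the normals $\nu_j$ of these facets can be completed to an integral basis of $\mathbb Z^{n+1}$. Put $\mathbb T^m=\mathbb R^m/2\pi\mathbb Z^m$, let $\beta:\mathbb R^d\to\mathbb R^{n+1}$ be the linear map with $\beta(e_j)=\nu_j$, and let $K$ be the kernel of the induced homomorphism $\mathbb T^d\to\mathbb T^{n+1}$. Let $(W,\omega,X)$ be the good toric symplectic cone determined by $C$, i.e. the symplectic reduction $W=Z/K$ of $(\mathbb C^d\setminus\{0\},\omega_{\rm st},X_{\rm st})$ by $K$, where \[ \omega_{\rm st}=\sum_j du_j\wedge dv_j\ \ (z_j=u_j+iv_j),\qquad X_{\rm st}=\text{radial vector field},\qquad Z=\Big\{z\ne0:\ \sum_j k_j|z_j|^2=0\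 \text{ for all } k\in\ker\beta\Big\}. \] Let $\nu=\beta(a)=\sum_{j=1}^d a_j\nu_j$ with all $a_j>0$, and suppose that the one-parameter subgroup of $\mathbb T^{n+1}$ generated by $\nu$ is dense in $\mathbb T^{n+1}$. Let $N=S_a/K$, where \[ S_a=\Big\{z\in Z:\ \sum_j a_j|z_j|^2=1\Big\}, \] be the corresponding toric contact manifold (a section of $W\to W/\mathbb R$), and let $\alpha_\nu$ be its Sasaki contact form, i.e. the form on $N$ whose pull-back to $S_a$ is the restriction of $\alpha_{\rm st}=\iota(X_{\rm st})\omega_{\rm st}$. Let $R_\nu$ be the Reeb vector field of $\alpha_\nu$: $\alpha_\nu(R_\nu)=1$, $\iota(R_\nu)\,d\alpha_\nu=0$. Then $R_\nu$ has exactly $m$ simple closed orbits (periodic orbits counted as subsets of $N$), where $m$ is the (finite) number of edges, i.e. one-dimensional faces, of $C$. -/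

import Mathlib

namespace ToricContact

noncomputable section

/-! ### Good cones -/

/-- The linear map `β : ℝ^d → ℝ^(n+1)`, `β(e_j) = ν_j`. -/
def beta {n d : ℕ} (ν : Fin d → Fin (n + 1) → ℤ) :
    (Fin d → ℝ) →ₗ[ℝ] (Fin (n + 1) → ℝ) where
  toFun a := fun i => ∑ j, a j * (ν j i : ℝ)
  map_add' a b := by
    funext i
    simp [add_mul, Finset.sum_add_distrib]
  map_smul' c a := by
    funext i
    simp [Finset.mul_sum, mul_assoc]

/-- The linear function `ℓ_j(x) = ⟨x, ν_j⟩`. -/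
def ell {n d : ℕ} (ν : Fin d → Fin (n + 1) → ℤ) (j : Fin d) (x : Fin (n + 1) → ℝ) : ℝ :=
  ∑ i, x i * (ν j i : ℝ)

/-- The cone `C = {x : ℓ_j(x) ≥ 0 for all j}`. -/
def cone {n d : ℕ} (ν : Fin d → Fin (n + 1) → ℤ) : PointedCone ℝ (Fin (n + 1) → ℝ) where
  carrier := {x | ∀ j, 0 ≤ ell ν j x}
  add_mem' {x y} hx hy j := by
    have h : ell ν j (x + y) = ell ν j x + ell ν j y := by
      simp [ell, add_mul, Finset.sum_add_distrib]
    rw [h]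
    exact add_nonneg (hx j) (hy j)
  zero_mem' j := by simp [ell]
  smul_mem' c x hx j := by
    have h : ell ν j (c • x) = (c : ℝ) * ell ν j x := by
      simp only [ell, Finset.mul_sum, Pi.smul_apply]
      exact Finset.sum_congr rfl fun i _ => mul_assoc (c : ℝ) (x i) (ν j i : ℝ)
    rw [h]
    exact mul_nonneg c.2 (hx j)

/-- The dimension of a cone, i.e. of its linear span. -/
def coneDim {m : ℕ} (F : PointedCone ℝ (Fin m → ℝ)) : ℕ :=
  Module.finrank ℝ (Submodule.span ℝ (F : Set (Fin m → ℝ)))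

/-- The edges (one-dimensional faces) of a cone. -/
def edges {m : ℕ} (C : PointedCone ℝ (Fin m → ℝ)) : Set (PointedCone ℝ (Fin m → ℝ)) :=
  {E | E.IsFaceOf C ∧ coneDim E = 1}

/-- `ν_1, …, ν_d` are the normals of a good cone in `ℝ^(n+1)`: they are primitive integral
vectors, none of the inequalities `ℓ_j ≥ 0` is redundant, and for `1 ≤ k ≤ n` every face of
codimension `k` lies on exactly `k` of the facets `C ∩ {ℓ_j = 0}`, is their intersection, and
their normals can be completed to a basis of `ℤ^(n+1)`. -/
structure IsGoodCone {n d : ℕ} (ν : Fin d → Fin (n + 1) → ℤ) : Prop where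
  le_card : n + 1 ≤ d
  primitive : ∀ j, ∀ c : ℤ, (∀ i, c ∣ ν j i) → IsUnit c
  minimal : ∀ j, ∃ x, (∀ i, i ≠ j → 0 ≤ ell ν i x) ∧ ell ν j x < 0
  faces : ∀ (k : ℕ) (F : PointedCone ℝ (Fin (n + 1) → ℝ)), 1 ≤ k → k ≤ n →
    F.IsFaceOf (cone ν) → coneDim F + k = n + 1 →
    ∃ s : Finset (Fin d), s.card = k ∧
      (∀ j, j ∈ s ↔ ∀ x ∈ F, ell ν j x = 0) ∧
      (∀ x, x ∈ F ↔ x ∈ cone ν ∧ ∀ j ∈ s, ell ν j x = 0) ∧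
      ∃ b : Module.Basis (Fin (n + 1)) ℤ (Fin (n + 1) → ℤ), ∀ j ∈ s, ν j ∈ Set.range b

/-! ### Tori -/

/-- The torus `𝕋^m = ℝ^m / 2πℤ^m`. -/
abbrev Torus (m : ℕ) : Type := Fin m → Real.Angle

/-- The homomorphism `𝕋^d → 𝕋^(n+1)` induced by `β`. -/
def betaTorus {n d : ℕ} (ν : Fin d → Fin (n + 1) → ℤ) : Torus d →+ Torus (n + 1) where
  toFun y := fun i => ∑ j, ν j i • y j
  map_zero' := by
    funext i
    simp
  map_add' x y := by
    funext i
    simp [smul_add, Finset.sum_add_distrib]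

/-- The group `K = ker(𝕋^d → 𝕋^(n+1))`. Its Lie algebra is `ker β`. -/
def K {n d : ℕ} (ν : Fin d → Fin (n + 1) → ℤ) : AddSubgroup (Torus d) := (betaTorus ν).ker

/-- The one-parameter subgroup of `𝕋^m` generated by `w ∈ ℝ^m`. -/
def oneParam {m : ℕ} (w : Fin m → ℝ) (t : ℝ) : Torus m := fun i => ((t * w i : ℝ) : Real.Angle)

/-- The standard action of `𝕋^d` on `ℂ^d`. -/
def act {d : ℕ} (y : Torus d) (z : Fin d → ℂ) : Fin d → ℂ :=
  fun j => ((y j).toCircle : ℂ) * z j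

theorem act_zero {d : ℕ} (z : Fin d → ℂ) : act 0 z = z := by
  funext j
  simp [act]

theorem act_add {d : ℕ} (x y : Torus d) (z : Fin d → ℂ) :
    act (x + y) z = act x (act y z) := by
  funext j
  simp [act, mul_assoc]

/-! ### The symplectic reduction and the Sasaki contact form -/

/-- The component `⟨φ_K, k⟩ = ∑ k_j |z_j|² / 2` of the moment map of the `K`-action on `ℂ^d`,
for `k` in the Lie algebra `ker β` of `K`. -/
def phiK {d : ℕ} (k : Fin d → ℝ) (z : Fin d → ℂ) : ℝ := ∑ j, k j * (Complex.normSq (z j) / 2)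

/-- `Z = φ_K⁻¹(0) ∖ {0}`; the toric symplectic cone of `C` is `W = Z / K`. -/
def Z {n d : ℕ} (ν : Fin d → Fin (n + 1) → ℤ) : Set (Fin d → ℂ) :=
  {z | z ≠ 0 ∧ ∀ k ∈ LinearMap.ker (beta ν), phiK k z = 0}

/-- The standard symplectic form `∑ du_j ∧ dv_j` of `ℂ^d`, where `z_j = u_j + i v_j`. -/
def omegaSt {d : ℕ} (v w : Fin d → ℂ) : ℝ :=
  ∑ j, ((v j).re * (w j).im - (v j).im * (w j).re)

/-- The one-form `α_st = ι(X_st) ω_st` on `ℂ^d`, where `X_st` is the radial vector field. -/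
def alphaSt {d : ℕ} (z v : Fin d → ℂ) : ℝ := omegaSt z v

/-- The exterior derivative of a one-form `θ` on `ℂ^d`. -/
def extD {d : ℕ} (θ : (Fin d → ℂ) → (Fin d → ℂ) → ℝ) (z v w : Fin d → ℂ) : ℝ :=
  fderiv ℝ (fun p => θ p w) z v - fderiv ℝ (fun p => θ p v) z w

/-- The vector field on `ℂ^d` generated by `a ∈ ℝ^d`, the Lie algebra of `𝕋^d`. -/
def generator {d : ℕ} (a : Fin d → ℝ) (z : Fin d → ℂ) : Fin d → ℂ :=
  fun j => Complex.I * (a j : ℂ) * z j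

/-- The hypersurface `S_a = {z ∈ Z : α_st(generator a) = 1} = {z ∈ Z : ∑ a_j |z_j|² = 1}`. Its
image in `W` is the image of the section of `W → W / ℝ` that defines the Sasaki contact form
of the Reeb vector `β(a)`. -/
def S {n d : ℕ} (ν : Fin d → Fin (n + 1) → ℤ) (a : Fin d → ℝ) : Set (Fin d → ℂ) :=
  {z | z ∈ Z ν ∧ alphaSt z (generator a z) = 1}

/-- The tangent space of `S_a` at `z`: the common kernel of the differentials of the functions
`⟨φ_K, k⟩`, `k ∈ ker β`, and `α_st(generator a)` that define `S_a`. -/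
def IsTangent {n d : ℕ} (ν : Fin d → Fin (n + 1) → ℤ) (a : Fin d → ℝ) (z v : Fin d → ℂ) : Prop :=
  (∀ k ∈ LinearMap.ker (beta ν), fderiv ℝ (phiK k) z v = 0) ∧
    fderiv ℝ (fun p => alphaSt p (generator a p)) z v = 0

/-- Two points of `S_a` are equivalent if they lie on the same `K`-orbit. -/
def orbitSetoid {n d : ℕ} (ν : Fin d → Fin (n + 1) → ℤ) (a : Fin d → ℝ) : Setoid (S ν a) where
  r z w := ∃ y ∈ K ν, act y z.1 = w.1
  iseqv :=
    { refl := fun z => ⟨0, (K ν).zero_mem, act_zero z.1⟩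
      symm := by
        rintro z w ⟨y, hy, h⟩
        refine ⟨-y, (K ν).neg_mem hy, ?_⟩
        rw [← h, ← act_add, neg_add_cancel, act_zero]
      trans := by
        rintro z w u ⟨y, hy, h⟩ ⟨x, hx, h'⟩
        refine ⟨x + y, (K ν).add_mem hx hy, ?_⟩
        rw [act_add, h, h'] }

/-- The toric contact manifold `N = S_a / K` (identified with `W / ℝ`). The restriction of
`α_st` to `S_a` is the pull-back, under the principal `K`-bundle `S_a → N`, of the Sasaki
contact form of `β(a)` on `N`. -/
def N {n d : ℕ} (ν : Fin d → Fin (n + 1) → ℤ) (a : Fin d → ℝ) : Type :=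
  Quotient (orbitSetoid ν a)

/-- The projection `S_a → N`. -/
def proj {n d : ℕ} (ν : Fin d → Fin (n + 1) → ℤ) (a : Fin d → ℝ) (z : S ν a) : N ν a :=
  Quotient.mk (orbitSetoid ν a) z

/-! ### The Reeb flow -/

/-- The tangent vector `v` of `S_a` at `z` is a lift of the value at `[z] ∈ N` of the Reeb vector
field of the Sasaki contact form `α`. Since `S_a → N` is a submersion that pulls `α` back to the
restriction of `α_st`, the conditions `α(R) = 1` and `ι(R) dα = 0` on `N` say exactly that
`α_st(v) = 1` and `dα_st(v, w) = 0` for all `w` tangent to `S_a`. -/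
def IsReebLift {n d : ℕ} (ν : Fin d → Fin (n + 1) → ℤ) (a : Fin d → ℝ) (z v : Fin d → ℂ) : Prop :=
  IsTangent ν a z v ∧ alphaSt z v = 1 ∧ ∀ w, IsTangent ν a z w → extD alphaSt z v w = 0

/-- `γ : ℝ → N` is an integral curve of the Reeb vector field: it is the projection of a curve
in `S_a` whose velocity lifts the Reeb vector field at every time. -/
def IsReebTrajectory {n d : ℕ} (ν : Fin d → Fin (n + 1) → ℤ) (a : Fin d → ℝ)
    (γ : ℝ → N ν a) : Prop :=
  ∃ c : ℝ → S ν a, (∀ t, γ t = proj ν a (c t)) ∧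
    ∀ t, ∃ v, HasDerivAt (fun s => (c s : Fin d → ℂ)) v t ∧ IsReebLift ν a (c t) v

/-- The simple closed orbits of the Reeb vector field, up to a shift of time: the images of the
integral curves `γ` that have a period `T > 0` and are injective on `[0, T)`. -/
def simpleClosedReebOrbits {n d : ℕ} (ν : Fin d → Fin (n + 1) → ℤ) (a : Fin d → ℝ) :
    Set (Set (N ν a)) :=
  {O | ∃ (γ : ℝ → N ν a) (T : ℝ), IsReebTrajectory ν a γ ∧ 0 < T ∧ Function.Periodic γ T ∧
    Set.InjOn γ (Set.Ico 0 T) ∧ O = Set.range γ}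

end

end ToricContact

/-! The moment map sends a point of `N` represented by `z` to the `x ∈ C` with `ℓ_j(x) = |z_j|²`;
the condition defining `S_a` becomes `⟨x, ν⟩ = 1`. The Reeb flow lifts to `z_j ↦ exp(i t a_j) z_j`,
up to rotations in `K` (`isReebTrajectory_iff`), so it preserves every fibre of the moment map.

Suppose an orbit over `x` has period `T > 0`. For every integral `m` in the span of the smallest
face containing `x`, `T⟨m, ν⟩ ∈ 2πℤ` (`exists_int_of_period`). Two such vectors `u`, `v` then have
an integral combination orthogonal to `ν`. Density of the subgroup generated by `ν` makes that
combination zero, so `u` and `v` are proportional. The span of the face is cut out by integral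
equations, so it is a line and `x` lies on an edge (`inFaceSpan_subset_line`).

Conversely, over a point `x` of an edge the normals of the facets through `x` span the hyperplane
orthogonal to `x`. Modulo `K` and the stabilizer of `z`, only the component `⟨x, ·⟩` of a rotation
matters. The flow is therefore transitive on the fibre (`fiber_eq_range`), and its periods form a
nonzero discrete group (`exists_isLeast_period`).

So closed orbits and edges are both injective images of the finite set `edgePoints`: the points of
the edges in the slice `⟨x, ν⟩ = 1`, one on each edge. -/

namespace ToricContact

open Real

variable {n d : ℕ}

/-! ### Arithmetic of the normals -/

/-- An integral vector, viewed in `ℝ^m`. -/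
def intVec {m : ℕ} (v : Fin m → ℤ) : Fin m → ℝ := fun i => (v i : ℝ)

/-- The linear functions that vanish at `x` also vanish at `y`, i.e. `y` lies in the linear
subspace spanned by the smallest face containing `x`. -/
def InFaceSpan (ν : Fin d → Fin (n + 1) → ℤ) (x y : Fin (n + 1) → ℝ) : Prop :=
  ∀ j, ell ν j x = 0 → ell ν j y = 0

theorem ell_add (ν : Fin d → Fin (n + 1) → ℤ) (j : Fin d) (x y : Fin (n + 1) → ℝ) :
    ell ν j (x + y) = ell ν j x + ell ν j y := by
  simp [ell, add_mul, Finset.sum_add_distrib]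

theorem ell_smul (ν : Fin d → Fin (n + 1) → ℤ) (j : Fin d) (c : ℝ) (x : Fin (n + 1) → ℝ) :
    ell ν j (c • x) = c * ell ν j x := by
  simp [ell, Finset.mul_sum, mul_assoc]

/-- `beta` and `x ↦ (ℓ_j(x))_j` are transposes of each other; this identity moves pairings between
`ℝ^d` and `ℝ^(n+1)`. -/
theorem sum_mul_beta (ν : Fin d → Fin (n + 1) → ℤ) (c : Fin d → ℝ) (x : Fin (n + 1) → ℝ) :
    ∑ i, x i * beta ν c i = ∑ j, c j * ell ν j x := by
  simp only [beta, ell, LinearMap.coe_mk, AddHom.coe_mk, Finset.mul_sum]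
  rw [Finset.sum_comm]
  exact Finset.sum_congr rfl fun j _ => Finset.sum_congr rfl fun i _ => by ring

theorem ell_intVec (ν : Fin d → Fin (n + 1) → ℤ) (j : Fin d) (m : Fin (n + 1) → ℤ) :
    ell ν j (intVec m) = ((∑ i, m i * ν j i : ℤ) : ℝ) := by
  simp [ell, intVec]

/-- If a real solution of a homogeneous linear system with integer coefficients is not
annihilated by an integral linear form, then neither is some integral solution. -/
theorem exists_intVec_solution {m : ℕ} (P : Set (Fin m → ℤ)) (c : Fin m → ℤ) (y : Fin m → ℝ)
    (hy : ∀ p ∈ P, ∑ i, y i * (p i : ℝ) = 0) (hc : ∑ i, y i * (c i : ℝ) ≠ 0) :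
    ∃ v : Fin m → ℤ, (∀ p ∈ P, ∑ i, v i * p i = 0) ∧ ∑ i, v i * c i ≠ 0 := by
  -- A `ℚ`-linear functional on `ℝ`, applied to each coordinate, respects integral equations and
  -- yields a rational solution; clearing denominators makes it integral.
  obtain ⟨f, hf⟩ : ∃ f : Module.Dual ℚ ℝ, f (∑ i, y i * (c i : ℝ)) ≠ 0 := by
    by_contra! h
    exact hc ((Module.forall_dual_apply_eq_zero_iff ℚ _).1 h)
  have key : ∀ p : Fin m → ℤ, f (∑ i, y i * (p i : ℝ)) = ∑ i, f (y i) * (p i : ℚ) := by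
    intro p
    rw [map_sum]
    refine Finset.sum_congr rfl fun i _ => ?_
    have : y i * (p i : ℝ) = (p i : ℚ) • y i := by
      rw [Rat.smul_def]; push_cast; ring
    rw [this, map_smul, smul_eq_mul, mul_comm]
  obtain ⟨b, hb⟩ := IsLocalization.exist_integer_multiples_of_finite (nonZeroDivisors ℤ)
    (fun i => f (y i))
  choose v hv using hb
  have hv' : ∀ i, (v i : ℚ) = ((b : ℤ) : ℚ) * f (y i) := by
    intro i
    have := hv i
    simpa using this
  have hb0 : ((b : ℤ) : ℚ) ≠ 0 := by
    exact_mod_cast nonZeroDivisors.ne_zero b.2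
  have key2 : ∀ p : Fin m → ℤ, ((∑ i, v i * p i : ℤ) : ℚ) =
      ((b : ℤ) : ℚ) * f (∑ i, y i * (p i : ℝ)) := by
    intro p
    rw [key, Finset.mul_sum]
    push_cast
    exact Finset.sum_congr rfl fun i _ => by rw [hv', mul_assoc]
  refine ⟨v, fun p hp => ?_, fun h => ?_⟩
  · have := key2 p
    rw [hy p hp, map_zero, mul_zero] at this
    exact_mod_cast this
  · have := key2 c
    rw [h] at this
    exact (mul_ne_zero hb0 hf) (by exact_mod_cast this.symm)

/-- A nonzero integral vector is not orthogonal to the generator of a dense one-parameter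
subgroup. -/
theorem intVec_eq_zero_of_denseRange {m : ℕ} {w : Fin m → ℝ} (hw : DenseRange (oneParam w))
    (v : Fin m → ℤ) (h : ∑ i, (v i : ℝ) * w i = 0) : v = 0 := by
  have hχ : Continuous fun y : Torus m => ∑ i, v i • y i :=
    continuous_finsetSum _ fun i _ => (continuous_zsmul (v i)).comp (continuous_apply i)
  have h0 : (fun y : Torus m => ∑ i, v i • y i) = fun _ => 0 := by
    refine hw.equalizer hχ continuous_const (funext fun t => ?_)
    have : ∑ i, v i • ((t * w i : ℝ) : Angle) = ((t * ∑ i, (v i : ℝ) * w i : ℝ) : Angle) := by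
      rw [Finset.mul_sum, ← Angle.coe_coeHom, map_sum]
      refine Finset.sum_congr rfl fun i _ => ?_
      rw [← map_zsmul]
      congr 1
      simp only [zsmul_eq_mul]; ring
    simp only [Function.comp, oneParam, this, h, mul_zero, Angle.coe_zero]
  funext i
  by_contra hi
  have hi' : (v i : ℝ) ≠ 0 := by exact_mod_cast hi
  -- The character given by `v` takes the value `π ≠ 0` at this point.
  have := congrFun h0 (Pi.single i ((π / v i : ℝ) : Angle))
  rw [Finset.sum_eq_single i (fun j _ hj => by simp [Pi.single_eq_of_ne hj]) (by simp),
    Pi.single_eq_same, ← Angle.coe_zsmul, zsmul_eq_mul, mul_div_cancel₀ _ hi'] at this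
  exact Angle.pi_ne_zero this

/-- The normals span `ℝ^(n+1)`: otherwise some nonzero integral vector is orthogonal to all of them,
hence to `ν`, against density. -/
theorem eq_zero_of_ell_eq_zero {ν : Fin d → Fin (n + 1) → ℤ} {a : Fin d → ℝ}
    (hdense : DenseRange (oneParam (beta ν a))) {x : Fin (n + 1) → ℝ}
    (hx : ∀ j, ell ν j x = 0) : x = 0 := by
  funext i
  by_contra hi
  obtain ⟨v, hv, hv'⟩ := exists_intVec_solution (Set.range ν) (Pi.single i 1) x
    (by rintro _ ⟨j, rfl⟩; exact hx j)
    (by rw [Finset.sum_eq_single i (fun j _ hj => by simp [Pi.single_eq_of_ne hj]) (by simp)]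
        simpa using hi)
  refine hv' ?_
  rw [intVec_eq_zero_of_denseRange hdense v]
  · simp
  · refine (sum_mul_beta ν a (intVec v)).trans (Finset.sum_eq_zero fun j _ => ?_)
    rw [ell_intVec, hv _ ⟨j, rfl⟩]
    simp

/-- If `T⟨m, w⟩ ∈ 2πℤ` for all integral `m` in the span of the smallest face containing `x`, where
`T ≠ 0` and `w` generates a dense one-parameter subgroup, then this face is at most a ray. -/
theorem inFaceSpan_subset_line {ν : Fin d → Fin (n + 1) → ℤ} {w : Fin (n + 1) → ℝ}
    (hdense : DenseRange (oneParam w)) {x : Fin (n + 1) → ℝ} (hx : x ≠ 0) {T : ℝ} (hT : T ≠ 0)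
    (h : ∀ m : Fin (n + 1) → ℤ, InFaceSpan ν x (intVec m) →
      ∃ p : ℤ, T * ∑ i, (m i : ℝ) * w i = 2 * π * p)
    (y : Fin (n + 1) → ℝ) (hy : InFaceSpan ν x y) : ∃ c : ℝ, y = c • x := by
  set P : Set (Fin (n + 1) → ℤ) := {p | ∃ j, ell ν j x = 0 ∧ p = ν j} with hP
  have hsol : ∀ y, InFaceSpan ν x y → ∀ p ∈ P, ∑ i, y i * (p i : ℝ) = 0 := by
    rintro y hy _ ⟨j, hj, rfl⟩
    exact hy j hj
  have hint : ∀ v : Fin (n + 1) → ℤ, (∀ p ∈ P, ∑ i, v i * p i = 0) →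
      InFaceSpan ν x (intVec v) := by
    intro v hv j hj
    rw [ell_intVec, hv _ ⟨j, hj, rfl⟩, Int.cast_zero]
  -- From `T⟨u, w⟩ = 2πp` and `T⟨v, w⟩ = 2πq` the integral vector `q u - p v` is orthogonal to `w`,
  -- so it vanishes. If `p = 0`, then `u` itself vanishes.
  have hprop : ∀ u v : Fin (n + 1) → ℤ, InFaceSpan ν x (intVec u) → InFaceSpan ν x (intVec v) →
      ∀ i k, v i * u k = v k * u i := by
    intro u v hu hv
    obtain ⟨p, hp⟩ := h u hu
    obtain ⟨q, hq⟩ := h v hv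
    have h1 : q • u - p • v = 0 := by
      apply intVec_eq_zero_of_denseRange hdense
      have : T * ∑ i, ((q • u - p • v) i : ℝ) * w i = 0 := by
        have e : ∑ i, ((q • u - p • v) i : ℝ) * w i =
            q * ∑ i, (u i : ℝ) * w i - p * ∑ i, (v i : ℝ) * w i := by
          rw [Finset.mul_sum, Finset.mul_sum, ← Finset.sum_sub_distrib]
          refine Finset.sum_congr rfl fun i _ => ?_
          simp; ring
        rw [e]
        linear_combination (q : ℝ) * hp - (p : ℝ) * hq
      exact (mul_eq_zero.1 this).resolve_left hT
    have h2 : ∀ i, q * u i = p * v i := fun i => by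
      have := congrFun h1 i
      simp at this
      linarith
    intro i k
    by_cases hpz : p = 0
    · have : u = 0 := by
        apply intVec_eq_zero_of_denseRange hdense
        rw [hpz] at hp
        simp at hp
        exact hp.resolve_left hT
      simp [this]
    · apply mul_left_cancel₀ hpz
      have e1 := h2 i
      have e2 := h2 k
      calc p * (v i * u k) = (p * v i) * u k := by ring
        _ = (q * u i) * u k := by rw [e1]
        _ = (q * u k) * u i := by ring
        _ = p * (v k * u i) := by rw [e2]; ring
  have hxs : InFaceSpan ν x x := fun j hj => hj
  obtain ⟨i, hi⟩ : ∃ i, x i ≠ 0 := by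
    by_contra! hcon
    exact hx (funext hcon)
  obtain ⟨u, hu, hui⟩ := exists_intVec_solution P (Pi.single i 1) x (hsol x hxs)
    (by rw [Finset.sum_eq_single i (fun j _ hj => by simp [Pi.single_eq_of_ne hj]) (by simp)]
        simpa using hi)
  rw [Finset.sum_eq_single i (fun j _ hj => by simp [Pi.single_eq_of_ne hj]) (by simp)] at hui
  simp only [Pi.single_eq_same, mul_one] at hui
  -- The minor `y ↦ y_k u_i - y_i u_k` is an integral form. If it were nonzero at a real `y`, it
  -- would be nonzero at some integral vector of the face span, contradicting `hprop`.
  have hline : ∀ y, InFaceSpan ν x y → ∀ k, y k * u i = y i * u k := by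
    intro y hy k
    by_contra hne
    obtain ⟨v, hv, hvk⟩ := exists_intVec_solution P (u i • Pi.single k 1 - u k • Pi.single i 1) y
      (hsol y hy) (by
        intro h0
        apply hne
        simp only [Pi.sub_apply, Pi.smul_apply, Pi.single_apply, smul_eq_mul, mul_ite, mul_one,
          mul_zero, Int.cast_sub, mul_sub, Finset.sum_sub_distrib, apply_ite (Int.cast : ℤ → ℝ),
          Int.cast_zero, Finset.sum_ite_eq', Finset.mem_univ, if_true] at h0
        linarith)
    apply hvk
    simp only [Pi.sub_apply, Pi.smul_apply, Pi.single_apply, smul_eq_mul, mul_ite, mul_one,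
          mul_zero, mul_sub, Finset.sum_sub_distrib,
          Finset.sum_ite_eq', Finset.mem_univ, if_true]
    have := hprop u v (hint u hu) (hint v hv) k i
    linarith
  have hui' : (u i : ℝ) ≠ 0 := by exact_mod_cast hui
  refine ⟨y i / x i, funext fun k => ?_⟩
  have h1 := hline y hy k
  have h2 := hline x hxs k
  simp only [Pi.smul_apply, smul_eq_mul]
  field_simp
  apply mul_right_cancel₀ hui'
  linear_combination x i * h1 - y i * h2

/-- A ray whose span is rational contains an integral vector. -/
theorem exists_intVec_of_line {ν : Fin d → Fin (n + 1) → ℤ} {x : Fin (n + 1) → ℝ} (hx : x ≠ 0)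
    (h : ∀ y, InFaceSpan ν x y → ∃ c : ℝ, y = c • x) :
    ∃ (m : Fin (n + 1) → ℤ) (c : ℝ), c ≠ 0 ∧ intVec m = c • x := by
  obtain ⟨i, hi⟩ : ∃ i, x i ≠ 0 := by
    by_contra! hcon
    exact hx (funext hcon)
  obtain ⟨u, hu, hui⟩ := exists_intVec_solution {p | ∃ j, ell ν j x = 0 ∧ p = ν j}
    (Pi.single i 1) x (by rintro _ ⟨j, hj, rfl⟩; exact hj)
    (by rw [Finset.sum_eq_single i (fun j _ hj => by simp [Pi.single_eq_of_ne hj]) (by simp)]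
        simpa using hi)
  rw [Finset.sum_eq_single i (fun j _ hj => by simp [Pi.single_eq_of_ne hj]) (by simp)] at hui
  simp only [Pi.single_eq_same, mul_one] at hui
  obtain ⟨c, hc⟩ := h (intVec u) fun j hj => by
    rw [ell_intVec, hu _ ⟨j, hj, rfl⟩, Int.cast_zero]
  refine ⟨u, c, ?_, hc⟩
  rintro rfl
  have := congrFun hc i
  simp [intVec] at this
  exact hui this

/-- Every vector orthogonal to `x` is a combination of the normals of the facets through `x`, if
these cut out a line. -/
theorem exists_beta_eq_of_line {ν : Fin d → Fin (n + 1) → ℤ} {x w : Fin (n + 1) → ℝ}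
    (h : ∀ y, InFaceSpan ν x y → ∃ c : ℝ, y = c • x) (hw : ∑ i, x i * w i = 0) :
    ∃ c : Fin d → ℝ, (∀ j, ell ν j x ≠ 0 → c j = 0) ∧ beta ν c = w := by
  let Q : Submodule ℝ (Fin d → ℝ) :=
    { carrier := {c | ∀ j, ell ν j x ≠ 0 → c j = 0}
      add_mem' := fun {c e} hc he j hj => by simp [hc j hj, he j hj]
      zero_mem' := fun j _ => rfl
      smul_mem' := fun r c hc j hj => by simp [hc j hj] }
  by_cases hmem : w ∈ Q.map (beta ν)
  · obtain ⟨c, hc, rfl⟩ := hmem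
    exact ⟨c, hc, rfl⟩
  exfalso
  -- A functional separating `w` from the span of these normals is the pairing with some `y`
  -- orthogonal to them all. Then `y` is a multiple of `x`, which is orthogonal to `w`.
  obtain ⟨f, hfw, hf⟩ := Submodule.exists_le_ker_of_notMem hmem
  set y : Fin (n + 1) → ℝ := fun i => f (Pi.single i 1) with hydef
  have hfy : ∀ v, f v = ∑ i, y i * v i := by
    intro v
    conv_lhs => rw [pi_eq_sum_univ' v]
    simp [hydef, mul_comm]
  obtain ⟨c, hc⟩ := h y (by
    intro j hj
    have hm : beta ν (Pi.single j 1) ∈ Q.map (beta ν) := by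
      refine ⟨_, fun i hi => ?_, rfl⟩
      have : i ≠ j := by rintro rfl; exact hi hj
      simp [Pi.single_eq_of_ne this]
    have := hf hm
    rw [LinearMap.mem_ker, hfy, sum_mul_beta,
      Finset.sum_eq_single j (fun i _ hi => by simp [Pi.single_eq_of_ne hi]) (by simp)] at this
    simpa using this)
  apply hfw
  rw [hfy, hc]
  simp only [Pi.smul_apply, smul_eq_mul, mul_assoc]
  rw [← Finset.mul_sum, hw, mul_zero]

/-! ### Edges -/

/-- The points of the edges of the cone at which the pairing with `w` is `1`. -/
def edgePoints (ν : Fin d → Fin (n + 1) → ℤ) (w : Fin (n + 1) → ℝ) : Set (Fin (n + 1) → ℝ) :=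
  {x | x ∈ cone ν ∧ ∑ i, x i * w i = 1 ∧ ∀ y, InFaceSpan ν x y → ∃ c : ℝ, y = c • x}

/-- The smallest face of the cone containing `x`. -/
def faceOf (ν : Fin d → Fin (n + 1) → ℤ) (x : Fin (n + 1) → ℝ) :
    PointedCone ℝ (Fin (n + 1) → ℝ) where
  carrier := {y | y ∈ cone ν ∧ InFaceSpan ν x y}
  add_mem' {y z} hy hz := ⟨add_mem hy.1 hz.1, fun j hj => by
    rw [ell_add, hy.2 j hj, hz.2 j hj, add_zero]⟩
  zero_mem' := ⟨zero_mem _, fun j _ => by simp [ell]⟩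
  smul_mem' c y hy := ⟨(cone ν).smul_mem c.2 hy.1, fun j hj => by
    have := ell_smul ν j (c : ℝ) y
    rw [hy.2 j hj, mul_zero] at this
    exact this⟩

theorem mem_faceOf {ν : Fin d → Fin (n + 1) → ℤ} {x y : Fin (n + 1) → ℝ} :
    y ∈ faceOf ν x ↔ y ∈ cone ν ∧ InFaceSpan ν x y := Iff.rfl

theorem mem_cone {ν : Fin d → Fin (n + 1) → ℤ} {x : Fin (n + 1) → ℝ} :
    x ∈ cone ν ↔ ∀ j, 0 ≤ ell ν j x := Iff.rfl

theorem faceOf_isFaceOf (ν : Fin d → Fin (n + 1) → ℤ) (x : Fin (n + 1) → ℝ) :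
    (faceOf ν x).IsFaceOf (cone ν) where
  le y hy := hy.1
  mem_of_smul_add_mem {y z c} hy hz hc h := by
    refine ⟨hy, fun j hj => ?_⟩
    have h0 := h.2 j hj
    rw [ell_add, ell_smul] at h0
    have h1 := mul_nonneg hc.le (hy j)
    have h2 : c * ell ν j y = 0 := by linarith [hz j]
    exact (mul_eq_zero.1 h2).resolve_left hc.ne'

/-- Points of the span of the smallest face containing `x` can be reached from `x` inside the
cone. -/
theorem exists_add_smul_mem_cone {ν : Fin d → Fin (n + 1) → ℤ} {x y : Fin (n + 1) → ℝ}
    (hx : x ∈ cone ν) (hy : InFaceSpan ν x y) : ∃ ε : ℝ, 0 < ε ∧ x + ε • y ∈ cone ν := by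
  have h : ∀ j, ∀ᶠ ε in nhdsWithin (0 : ℝ) (Set.Ioi 0), 0 ≤ ell ν j (x + ε • y) := by
    intro j
    rcases (hx j).eq_or_lt with h0 | h0
    · refine Filter.Eventually.of_forall fun ε => ?_
      rw [ell_add, ell_smul, hy j h0.symm, ← h0]
      simp
    · have hc : Filter.Tendsto (fun ε : ℝ => ell ν j x + ε * ell ν j y)
          (nhdsWithin (0 : ℝ) (Set.Ioi 0)) (nhds (ell ν j x + 0 * ell ν j y)) :=
        Filter.Tendsto.mono_left (Continuous.tendsto (by fun_prop) 0) nhdsWithin_le_nhds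
      rw [zero_mul, add_zero] at hc
      filter_upwards [hc.eventually (lt_mem_nhds h0)] with ε hε
      rw [ell_add, ell_smul]
      exact hε.le
  obtain ⟨ε, hε, hpos⟩ := ((Filter.eventually_all.2 h).and self_mem_nhdsWithin).exists
  exact ⟨ε, hpos, hε⟩

/-- This positivity allows a nonzero point of an edge to be rescaled into the slice `⟨x, ν⟩ = 1`. -/
theorem sum_mul_beta_pos {ν : Fin d → Fin (n + 1) → ℤ} {a : Fin d → ℝ} (ha : ∀ j, 0 < a j)
    (hdense : DenseRange (oneParam (beta ν a))) {x : Fin (n + 1) → ℝ} (hx : x ∈ cone ν)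
    (hx0 : x ≠ 0) : 0 < ∑ i, x i * beta ν a i := by
  rw [sum_mul_beta]
  have hnn : ∀ j ∈ Finset.univ, 0 ≤ a j * ell ν j x := fun j _ => mul_nonneg (ha j).le (hx j)
  refine lt_of_le_of_ne (Finset.sum_nonneg hnn) fun h => hx0 ?_
  refine eq_zero_of_ell_eq_zero hdense fun j => ?_
  have := (Finset.sum_eq_zero_iff_of_nonneg hnn).1 h.symm j (Finset.mem_univ j)
  exact (mul_eq_zero.1 this).resolve_left (ha j).ne'

theorem ne_zero_of_mem_edgePoints {ν : Fin d → Fin (n + 1) → ℤ} {w x : Fin (n + 1) → ℝ}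
    (hx : x ∈ edgePoints ν w) : x ≠ 0 := by
  rintro rfl
  have := hx.2.1
  simp at this

theorem eq_of_inFaceSpan {ν : Fin d → Fin (n + 1) → ℤ} {w x y : Fin (n + 1) → ℝ}
    (hx : x ∈ edgePoints ν w) (hy : y ∈ edgePoints ν w) (h : InFaceSpan ν x y) : x = y := by
  obtain ⟨c, rfl⟩ := hx.2.2 y h
  have h1 := hy.2.1
  simp only [Pi.smul_apply, smul_eq_mul, mul_assoc] at h1
  rw [← Finset.mul_sum, hx.2.1, mul_one] at h1
  rw [h1, one_smul]

/-- An edge point is determined by the set of indices `j` with `ℓ_j(x) = 0`, and there are finitely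
many such sets. -/
theorem edgePoints_finite (ν : Fin d → Fin (n + 1) → ℤ) (w : Fin (n + 1) → ℝ) :
    (edgePoints ν w).Finite := by
  refine Set.Finite.of_injOn (f := fun x => {j | ell ν j x = 0}) (t := Set.univ)
    (fun _ _ => Set.mem_univ _) (fun x hx y hy hxy => ?_) Set.finite_univ
  refine eq_of_inFaceSpan hx hy fun j hj => ?_
  exact (Set.ext_iff.1 hxy j).1 hj

theorem injOn_faceOf (ν : Fin d → Fin (n + 1) → ℤ) (w : Fin (n + 1) → ℝ) :
    Set.InjOn (faceOf ν) (edgePoints ν w) := by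
  intro x hx y hy hxy
  have : y ∈ faceOf ν x := by rw [hxy]; exact ⟨hy.1, fun j hj => hj⟩
  exact eq_of_inFaceSpan hx hy this.2

theorem image_faceOf {ν : Fin d → Fin (n + 1) → ℤ} {a : Fin d → ℝ} (ha : ∀ j, 0 < a j)
    (hdense : DenseRange (oneParam (beta ν a))) :
    faceOf ν '' edgePoints ν (beta ν a) = edges (cone ν) := by
  ext E
  constructor
  · rintro ⟨x, hx, rfl⟩
    refine ⟨faceOf_isFaceOf ν x, ?_⟩
    have hmem : x ∈ faceOf ν x := ⟨hx.1, fun j hj => hj⟩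
    have hspan : Submodule.span ℝ (faceOf ν x : Set (Fin (n + 1) → ℝ)) = ℝ ∙ x := by
      apply le_antisymm
      · rw [Submodule.span_le]
        intro y hy
        obtain ⟨c, rfl⟩ := hx.2.2 y hy.2
        exact Submodule.smul_mem _ c (Submodule.mem_span_singleton_self x)
      · exact Submodule.span_mono (Set.singleton_subset_iff.2 hmem)
    rw [coneDim, hspan, finrank_span_singleton (ne_zero_of_mem_edgePoints hx)]
  · rintro ⟨hface, hdim⟩
    obtain ⟨y, hyE, hy0⟩ : ∃ y ∈ E, y ≠ 0 := by
      by_contra! hcon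
      have : Submodule.span ℝ (E : Set (Fin (n + 1) → ℝ)) = ⊥ :=
        Submodule.span_eq_bot.2 fun y hy => hcon y hy
      rw [coneDim, this, finrank_bot] at hdim
      exact zero_ne_one hdim
    have hpos := sum_mul_beta_pos ha hdense (hface.le hyE) hy0
    set r := ∑ i, y i * beta ν a i with hr
    set x := r⁻¹ • y with hxdef
    have hxE : x ∈ E := E.smul_mem (inv_pos.2 hpos).le hyE
    have hx0 : x ≠ 0 := smul_ne_zero (inv_pos.2 hpos).ne' hy0
    have hline : ∀ v ∈ Submodule.span ℝ (E : Set (Fin (n + 1) → ℝ)), ∃ c : ℝ, v = c • x := by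
      intro v hv
      obtain ⟨c, hc⟩ := (finrank_eq_one_iff_of_nonzero'
        (⟨x, Submodule.subset_span hxE⟩ : Submodule.span ℝ (E : Set (Fin (n + 1) → ℝ)))
        (fun h => hx0 (congrArg Subtype.val h))).1 hdim ⟨v, hv⟩
      exact ⟨c, (congrArg Subtype.val hc).symm⟩
    -- Both `x + εv` and `x - δv` lie in the cone, and a positive combination of them is a multiple
    -- of `x ∈ E`. The face property puts `x + εv` in `E`, so `v` lies in the span of `E`.
    have hU : ∀ v, InFaceSpan ν x v → ∃ c : ℝ, v = c • x := by
      intro v hv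
      have hneg : InFaceSpan ν x (-v) := fun j hj => by
        rw [← neg_one_smul ℝ v, ell_smul, hv j hj, mul_zero]
      obtain ⟨ε, hε, h1⟩ := exists_add_smul_mem_cone (hface.le hxE) hv
      obtain ⟨δ, hδ, h2⟩ := exists_add_smul_mem_cone (hface.le hxE) hneg
      have h3 : x + ε • v ∈ E := by
        refine hface.mem_of_smul_add_smul_mem_left h1 h2 hδ hε ?_
        have : δ • (x + ε • v) + ε • (x + δ • -v) = (δ + ε) • x := by module
        rw [this]
        exact E.smul_mem (add_pos hδ hε).le hxE
      apply hline
      have : v = ε⁻¹ • ((x + ε • v) - x) := by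
        rw [add_sub_cancel_left, smul_smul, inv_mul_cancel₀ hε.ne', one_smul]
      rw [this]
      exact Submodule.smul_mem _ _ (Submodule.sub_mem _ (Submodule.subset_span h3)
        (Submodule.subset_span hxE))
    refine ⟨x, ⟨hface.le hxE, ?_, hU⟩, ?_⟩
    · simp only [hxdef, Pi.smul_apply, smul_eq_mul, mul_assoc]
      rw [← Finset.mul_sum, ← hr, inv_mul_cancel₀ hpos.ne']
    · ext v
      rw [mem_faceOf]
      constructor
      · rintro ⟨hv, hv'⟩
        have hneg : InFaceSpan ν x (-v) := fun j hj => by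
          rw [← neg_one_smul ℝ v, ell_smul, hv' j hj, mul_zero]
        obtain ⟨δ, hδ, h2⟩ := exists_add_smul_mem_cone (hface.le hxE) hneg
        refine hface.mem_of_smul_add_mem hv h2 hδ ?_
        have : δ • v + (x + δ • -v) = x := by module
        rw [this]
        exact hxE
      · intro hv
        refine ⟨hface.le hv, fun j hj => ?_⟩
        obtain ⟨c, rfl⟩ := hline v (Submodule.subset_span hv)
        rw [ell_smul, hj, mul_zero]

/-! ### The Reeb vector field -/

theorem fderiv_phiK (k : Fin d → ℝ) (z v : Fin d → ℂ) :
    fderiv ℝ (phiK k) z v = ∑ j, k j * ((z j).re * (v j).re + (z j).im * (v j).im) := by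
  have hre : ∀ j, HasFDerivAt (fun p : Fin d → ℂ => (p j).re)
      (Complex.reCLM ∘L ContinuousLinearMap.proj (R := ℝ) (φ := fun _ : Fin d => ℂ) j) z :=
    fun j => (Complex.reCLM ∘L
      ContinuousLinearMap.proj (R := ℝ) (φ := fun _ : Fin d => ℂ) j).hasFDerivAt
  have him : ∀ j, HasFDerivAt (fun p : Fin d → ℂ => (p j).im)
      (Complex.imCLM ∘L ContinuousLinearMap.proj (R := ℝ) (φ := fun _ : Fin d => ℂ) j) z :=
    fun j => (Complex.imCLM ∘L
      ContinuousLinearMap.proj (R := ℝ) (φ := fun _ : Fin d => ℂ) j).hasFDerivAt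
  have h := HasFDerivAt.fun_sum (u := Finset.univ) fun j _ =>
    ((((hre j).mul (hre j)).add ((him j).mul (him j))).const_mul (k j / 2))
  have e : phiK k = fun p : Fin d → ℂ =>
      ∑ j, k j / 2 * ((p j).re * (p j).re + (p j).im * (p j).im) := by
    funext p
    exact Finset.sum_congr rfl fun j _ => by rw [Complex.normSq_apply]; ring
  rw [e]
  erw [h.fderiv]
  simp only [sum_apply, smul_apply, add_apply, ContinuousLinearMap.comp_apply, ContinuousLinearMap.proj_apply,
    Complex.reCLM_apply, Complex.imCLM_apply, smul_eq_mul]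
  exact Finset.sum_congr rfl fun j _ => by ring

theorem alphaSt_generator (k : Fin d → ℝ) (z : Fin d → ℂ) :
    alphaSt z (generator k z) = ∑ j, k j * Complex.normSq (z j) := by
  rw [alphaSt, omegaSt]
  refine Finset.sum_congr rfl fun j _ => ?_
  simp [generator, Complex.normSq_apply]
  ring

theorem isTangent_iff {ν : Fin d → Fin (n + 1) → ℤ} {a : Fin d → ℝ} {z v : Fin d → ℂ} :
    IsTangent ν a z v ↔
      (∀ k ∈ LinearMap.ker (beta ν), ∑ j, k j * ((z j).re * (v j).re + (z j).im * (v j).im) = 0) ∧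
        ∑ j, a j * ((z j).re * (v j).re + (z j).im * (v j).im) = 0 := by
  -- The factor 2 cancels the `1/2` in `phiK`.
  have e : (fun p : Fin d → ℂ => alphaSt p (generator a p)) = phiK (fun j => 2 * a j) := by
    funext p
    rw [alphaSt_generator]
    exact Finset.sum_congr rfl fun j _ => by ring
  simp only [IsTangent, e, fderiv_phiK, mul_assoc, ← Finset.mul_sum]
  simp

/-- The linear form `p ↦ ω_st(p, w)`. -/
def omegaRight (w : Fin d → ℂ) : (Fin d → ℂ) →ₗ[ℝ] ℝ where
  toFun p := omegaSt p w
  map_add' p q := by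
    simp only [omegaSt, ← Finset.sum_add_distrib]
    exact Finset.sum_congr rfl fun j _ => by simp; ring
  map_smul' c p := by
    simp only [omegaSt, RingHom.id_apply, smul_eq_mul, Finset.mul_sum]
    exact Finset.sum_congr rfl fun j _ => by simp; ring

theorem extD_alphaSt (z v w : Fin d → ℂ) : extD alphaSt z v w = 2 * omegaSt v w := by
  have h : ∀ u v : Fin d → ℂ, fderiv ℝ (fun p => alphaSt p u) z v = omegaSt v u := by
    intro u v
    have := (LinearMap.toContinuousLinearMap (omegaRight u)).hasFDerivAt (x := z)
    exact congrArg (fun L => L v) this.fderiv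
  rw [extD, h, h]
  simp only [omegaSt, two_mul, sub_eq_add_neg, ← Finset.sum_neg_distrib,
    ← Finset.sum_add_distrib]
  exact Finset.sum_congr rfl fun j _ => by ring

theorem mem_S_iff {ν : Fin d → Fin (n + 1) → ℤ} {a : Fin d → ℝ} {z : Fin d → ℂ} :
    z ∈ S ν a ↔ (∀ k ∈ LinearMap.ker (beta ν), ∑ j, k j * Complex.normSq (z j) = 0) ∧
      ∑ j, a j * Complex.normSq (z j) = 1 := by
  have e : ∀ k, phiK k z = (∑ j, k j * Complex.normSq (z j)) / 2 := fun k => by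
    rw [Finset.sum_div]
    exact Finset.sum_congr rfl fun j _ => by ring
  constructor
  · rintro ⟨⟨-, h⟩, h1⟩
    refine ⟨fun k hk => ?_, by rw [← h1, alphaSt_generator]⟩
    have := h k hk
    rw [e] at this
    linarith
  · rintro ⟨h, h1⟩
    refine ⟨⟨?_, fun k hk => by rw [e, h k hk, zero_div]⟩, by
      rw [alphaSt_generator, h1]⟩
    rintro rfl
    simp at h1

/-- Rotations preserve every `|z_j|²`, which gives tangency. Moreover `ω_st(generator a z, w) = -∑
a_j Re(conj(z_j) w_j)`, which vanishes because `w` is tangent to the level set of `∑ a_j |z_j|²`. -/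
theorem isReebLift_generator {ν : Fin d → Fin (n + 1) → ℤ} {a : Fin d → ℝ} {z : Fin d → ℂ}
    (hz : z ∈ S ν a) : IsReebLift ν a z (generator a z) := by
  have h0 : ∀ k : Fin d → ℝ, ∑ j, k j *
      ((z j).re * (generator a z j).re + (z j).im * (generator a z j).im) = 0 := by
    intro k
    refine Finset.sum_eq_zero fun j _ => ?_
    simp [generator]
    right; ring
  refine ⟨isTangent_iff.2 ⟨fun k _ => h0 k, h0 a⟩, hz.2, fun w hw => ?_⟩
  have := (isTangent_iff.1 hw).2
  rw [extD_alphaSt, ← mul_zero (-2 : ℝ), ← this, neg_mul, ← mul_neg, ← Finset.sum_neg_distrib]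
  congr 1
  refine Finset.sum_congr rfl fun j _ => ?_
  simp [generator]
  ring

/-- A lift of the Reeb vector field differs from the generator of `a` by the generator of an
element of the Lie algebra of `K`. -/
theorem IsReebLift.exists_eq_generator {ν : Fin d → Fin (n + 1) → ℤ} {a : Fin d → ℝ}
    {z v : Fin d → ℂ} (hz : z ∈ S ν a) (h : IsReebLift ν a z v) :
    ∃ k ∈ LinearMap.ker (beta ν), v = generator (a + k) z := by
  obtain ⟨-, h1, h2⟩ := h
  have h2' : ∀ w, IsTangent ν a z w → omegaSt v w = 0 := fun w hw => by
    have := h2 w hw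
    rw [extD_alphaSt] at this
    linarith
  -- Tangent vectors supported in one coordinate. Testing against them shows that `v_j` is a real
  -- multiple of `i z_j`, and zero where `z_j = 0`.
  have hsingle : ∀ j (u : ℂ), (z j).re * u.re + (z j).im * u.im = 0 →
      (v j).re * u.im - (v j).im * u.re = 0 := by
    intro j u hu
    have ht : IsTangent ν a z (Pi.single j u) := by
      have : ∀ k : Fin d → ℝ, ∑ i, k i * ((z i).re * ((Pi.single j u : Fin d → ℂ) i).re +
          (z i).im * ((Pi.single j u : Fin d → ℂ) i).im) = 0 := by
        intro k
        rw [Finset.sum_eq_single j (fun i _ hi => by simp [Pi.single_eq_of_ne hi]) (by simp)]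
        simp [hu]
      exact isTangent_iff.2 ⟨fun k _ => this k, this a⟩
    have := h2' _ ht
    rw [omegaSt,
      Finset.sum_eq_single j (fun i _ hi => by simp [Pi.single_eq_of_ne hi]) (by simp)] at this
    simpa using this
  have hs : ∀ j, ∃ s : ℝ, v j = Complex.I * (s : ℂ) * z j := by
    intro j
    by_cases hzj : z j = 0
    · refine ⟨0, ?_⟩
      have e1 := hsingle j 1 (by simp [hzj])
      have e2 := hsingle j Complex.I (by simp [hzj])
      simp at e1 e2
      apply Complex.ext <;> simp [e1, e2]
    · have e := hsingle j (Complex.I * z j) (by simp; ring)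
      simp at e
      have hn : (z j).re * (z j).re + (z j).im * (z j).im ≠ 0 := by
        rw [← Complex.normSq_apply]
        simpa using hzj
      obtain ⟨r, hr⟩ : ∃ r : ℝ, r * ((z j).re * (z j).re + (z j).im * (z j).im) =
          (z j).re * (v j).im - (z j).im * (v j).re := ⟨_, div_mul_cancel₀ _ hn⟩
      refine ⟨r, Complex.ext (mul_right_cancel₀ hn ?_) (mul_right_cancel₀ hn ?_)⟩
      · simp
        linear_combination (z j).re * e + (z j).im * hr
      · simp [-mul_eq_mul_right_iff]
        linear_combination (z j).im * e - (z j).re * hr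
  choose s hs using hs
  -- Only `s_j |z_j|²` is visible, so `s` is compared with `ker β + ℝa` after applying `D`. A
  -- functional `r` vanishing on the image of `ker β + ℝa` makes `(r_j z_j)` tangent, and pairing
  -- `v` with this vector gives `-∑ r_j s_j |z_j|² = 0`.
  let D : (Fin d → ℝ) →ₗ[ℝ] (Fin d → ℝ) :=
    { toFun := fun k j => k j * Complex.normSq (z j)
      map_add' := fun k l => funext fun j => by simp [add_mul]
      map_smul' := fun c k => funext fun j => by simp [mul_assoc] }
  have hmem : D s ∈ (LinearMap.ker (beta ν) ⊔ ℝ ∙ a).map D := by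
    by_contra hcon
    obtain ⟨f, hfs, hf⟩ := Submodule.exists_le_ker_of_notMem hcon
    set r : Fin d → ℝ := fun i => f (Pi.single i 1) with hr
    have hfy : ∀ u, f u = ∑ i, r i * u i := by
      intro u
      conv_lhs => rw [pi_eq_sum_univ' u]
      simp [hr, mul_comm]
    have hker : ∀ k ∈ LinearMap.ker (beta ν) ⊔ ℝ ∙ a,
        ∑ j, k j * ((z j).re * ((r j : ℂ) * z j).re + (z j).im * ((r j : ℂ) * z j).im) = 0 := by
      intro k hk
      have := hf (Submodule.mem_map_of_mem (f := D) hk)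
      rw [LinearMap.mem_ker, hfy] at this
      rw [← this]
      refine Finset.sum_congr rfl fun j _ => ?_
      simp [D, Complex.normSq_apply]
      ring
    have := h2' (fun j => (r j : ℂ) * z j) (isTangent_iff.2
      ⟨fun k hk => hker k (Submodule.mem_sup_left hk),
        hker a (Submodule.mem_sup_right (Submodule.mem_span_singleton_self a))⟩)
    apply hfs
    rw [hfy, ← neg_eq_zero, ← this, ← Finset.sum_neg_distrib]
    refine Finset.sum_congr rfl fun j _ => ?_
    rw [hs]
    simp [D, Complex.normSq_apply]
    ring
  obtain ⟨p, hp, hps⟩ := hmem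
  obtain ⟨k, hk, l, hl, rfl⟩ := Submodule.mem_sup.1 hp
  obtain ⟨c, rfl⟩ := Submodule.mem_span_singleton.1 hl
  have hv : v = generator (c • a + k) z := by
    funext j
    rw [hs]
    by_cases hzj : z j = 0
    · simp [generator, hzj]
    · have := congrFun hps j
      simp only [D, LinearMap.coe_mk, AddHom.coe_mk] at this
      have hn : Complex.normSq (z j) ≠ 0 := by simpa using hzj
      rw [generator, ← mul_right_cancel₀ hn this, add_comm]
  -- On `S_a` the `ker β` part contributes nothing to `α_st(v)`, so `α_st(v) = 1` reads `c = 1`.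
  have hc : c = 1 := by
    obtain ⟨hz1, hz2⟩ := mem_S_iff.1 hz
    rw [hv, alphaSt_generator] at h1
    simp only [Pi.add_apply, Pi.smul_apply, smul_eq_mul, add_mul, Finset.sum_add_distrib,
      mul_assoc] at h1
    rw [hz1 k hk, ← Finset.mul_sum, hz2] at h1
    linarith
  exact ⟨k, hk, by rw [hv, hc, one_smul]⟩

/-! ### The Reeb flow -/

theorem normSq_act (y : Torus d) (z : Fin d → ℂ) (j : Fin d) :
    Complex.normSq (act y z j) = Complex.normSq (z j) := by
  simp [act]

theorem act_mem_S {ν : Fin d → Fin (n + 1) → ℤ} {a : Fin d → ℝ} (y : Torus d) {z : Fin d → ℂ}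
    (hz : z ∈ S ν a) : act y z ∈ S ν a := by
  rw [mem_S_iff] at hz ⊢
  simpa only [normSq_act] using hz

/-- The action of `𝕋^d` on `S_a`. -/
noncomputable def actS (ν : Fin d → Fin (n + 1) → ℤ) (a : Fin d → ℝ) (y : Torus d) (z : S ν a) : S ν a :=
  ⟨act y z.1, act_mem_S y z.2⟩

theorem actS_add (ν : Fin d → Fin (n + 1) → ℤ) (a : Fin d → ℝ) (x y : Torus d) (z : S ν a) :
    actS ν a (x + y) z = actS ν a x (actS ν a y z) :=
  Subtype.ext (act_add x y z.1)

theorem actS_zero (ν : Fin d → Fin (n + 1) → ℤ) (a : Fin d → ℝ) (z : S ν a) :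
    actS ν a 0 z = z :=
  Subtype.ext (act_zero z.1)

theorem proj_eq_iff {ν : Fin d → Fin (n + 1) → ℤ} {a : Fin d → ℝ} {z w : S ν a} :
    proj ν a z = proj ν a w ↔ ∃ y ∈ K ν, act y z.1 = w.1 :=
  Quotient.eq (r := orbitSetoid ν a)

theorem proj_actS_congr {ν : Fin d → Fin (n + 1) → ℤ} {a : Fin d → ℝ} {z w : S ν a}
    (x : Torus d) (h : proj ν a z = proj ν a w) :
    proj ν a (actS ν a x z) = proj ν a (actS ν a x w) := by
  obtain ⟨y, hy, h⟩ := proj_eq_iff.1 h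
  refine proj_eq_iff.2 ⟨y, hy, ?_⟩
  change act y (act x z.1) = act x w.1
  rw [← h, ← act_add, ← act_add, add_comm]

theorem oneParam_add {m : ℕ} (w : Fin m → ℝ) (s t : ℝ) :
    oneParam w (s + t) = oneParam w s + oneParam w t := by
  funext i
  simp [oneParam, add_mul]

theorem oneParam_zero {m : ℕ} (w : Fin m → ℝ) : oneParam w 0 = 0 := by
  funext i
  simp [oneParam]

theorem act_coe (r : Fin d → ℝ) (z : Fin d → ℂ) (j : Fin d) :
    act (fun i => ((r i : ℝ) : Angle)) z j = Complex.exp (r j * Complex.I) * z j := by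
  simp [act, Circle.coe_exp]

theorem act_oneParam (w : Fin d → ℝ) (t : ℝ) (z : Fin d → ℂ) (j : Fin d) :
    act (oneParam w t) z j = Complex.exp (((t * w j : ℝ) : ℂ) * Complex.I) * z j :=
  act_coe (fun i => t * w i) z j

theorem betaTorus_coe (ν : Fin d → Fin (n + 1) → ℤ) (r : Fin d → ℝ) :
    betaTorus ν (fun i => ((r i : ℝ) : Angle)) = fun i => ((beta ν r i : ℝ) : Angle) := by
  funext i
  simp only [betaTorus, beta, AddMonoidHom.coe_mk, ZeroHom.coe_mk, LinearMap.coe_mk, AddHom.coe_mk]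
  rw [← Angle.coe_coeHom, map_sum]
  refine Finset.sum_congr rfl fun j _ => ?_
  rw [← map_zsmul, zsmul_eq_mul, mul_comm]

/-- A curve whose velocity stays in a linear subspace stays in this subspace. -/
theorem mem_submodule_of_hasDerivAt {E : Type*} [NormedAddCommGroup E] [NormedSpace ℝ E]
    [FiniteDimensional ℝ E] (P : Submodule ℝ E) {s : Set ℝ} (hs : IsOpen s)
    (hs' : IsPreconnected s) {g : ℝ → E} (hg : ∀ t ∈ s, ∃ v ∈ P, HasDerivAt g v t) {t₀ : ℝ}
    (ht₀ : t₀ ∈ s) (h₀ : g t₀ ∈ P) {t : ℝ} (ht : t ∈ s) : g t ∈ P := by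
  by_contra hcon
  obtain ⟨f, hfs, hf⟩ := Submodule.exists_le_ker_of_notMem hcon
  have hder : ∀ t ∈ s, HasDerivAt (fun t => f (g t)) 0 t := by
    intro t ht
    obtain ⟨v, hv, hv'⟩ := hg t ht
    have := (LinearMap.toContinuousLinearMap f).hasFDerivAt.comp_hasDerivAt t hv'
    have e : (LinearMap.toContinuousLinearMap f) v = 0 := hf hv
    rw [e] at this
    exact this
  have := hs.is_const_of_deriv_eq_zero hs'
    (fun t ht => (hder t ht).differentiableAt.differentiableWithinAt)
    (fun t ht => (hder t ht).deriv) ht ht₀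
  exact hfs (this.trans (hf h₀))

/-- Here `c_j' = i(a_j + k_j)c_j` with `k ∈ ker β` depending on time, with no continuity known.
Instead of integrating `k`, the proof subtracts `i(t - t₀)a_j` from `log(c_j(t)/c_j(t₀))`: the
result has velocity in the fixed subspace `i ker β`, so it stays there, and exponentiating gives the
element of `K`. -/
theorem eventually_exists_eq_act {ν : Fin d → Fin (n + 1) → ℤ} {a : Fin d → ℝ} {c : ℝ → S ν a}
    (hc : ∀ t, ∃ v, HasDerivAt (fun s => (c s : Fin d → ℂ)) v t ∧ IsReebLift ν a (c t) v)
    (t₀ : ℝ) : ∀ᶠ t in nhds t₀, ∃ y ∈ K ν,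
      act y (act (oneParam a (t - t₀)) (c t₀ : Fin d → ℂ)) = c t := by
  have hk : ∀ t, ∃ k ∈ LinearMap.ker (beta ν), ∀ j,
      HasDerivAt (fun s => (c s : Fin d → ℂ) j)
        (Complex.I * ((a j + k j : ℝ) : ℂ) * (c t : Fin d → ℂ) j) t := by
    intro t
    obtain ⟨v, hv, hR⟩ := hc t
    obtain ⟨k, hk, rfl⟩ := hR.exists_eq_generator (c t).2
    exact ⟨k, hk, fun j => hasDerivAt_pi.1 hv j⟩
  have hnorm : ∀ t j, Complex.normSq ((c t : Fin d → ℂ) j) =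
      Complex.normSq ((c t₀ : Fin d → ℂ) j) := by
    intro t j
    have hd : ∀ t, HasDerivAt (fun s => Complex.normSq ((c s : Fin d → ℂ) j)) 0 t := by
      intro t
      obtain ⟨k, -, hkj⟩ := hk t
      have hre := Complex.reCLM.hasFDerivAt.comp_hasDerivAt t (hkj j)
      have him := Complex.imCLM.hasFDerivAt.comp_hasDerivAt t (hkj j)
      have := (hre.mul hre).add (him.mul him)
      refine (this.congr_deriv ?_).congr_of_eventuallyEq
        (Filter.Eventually.of_forall fun s => Complex.normSq_apply _)
      simp
      ring
    exact is_const_of_deriv_eq_zero (fun t => (hd t).differentiableAt) (fun t => (hd t).deriv) t t₀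
  -- Coordinates with `c_j(t₀) = 0` are left free: they remain zero by `hnorm`, whatever the
  -- rotation.
  let P : Submodule ℝ (Fin d → ℂ) :=
    { carrier := {g | ∃ k ∈ LinearMap.ker (beta ν), ∀ j, (c t₀ : Fin d → ℂ) j ≠ 0 →
        g j = Complex.I * (k j : ℂ)}
      add_mem' := by
        rintro g h ⟨k, hk, hg⟩ ⟨l, hl, hh⟩
        refine ⟨k + l, add_mem hk hl, fun j hj => ?_⟩
        simp [hg j hj, hh j hj, mul_add]
      zero_mem' := ⟨0, zero_mem _, fun j _ => by simp⟩
      smul_mem' := by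
        rintro r g ⟨k, hk, hg⟩
        refine ⟨r • k, Submodule.smul_mem _ r hk, fun j hj => ?_⟩
        simp [hg j hj]
        ring }
  set g : ℝ → Fin d → ℂ := fun t j =>
    Complex.log ((c t : Fin d → ℂ) j / (c t₀ : Fin d → ℂ) j) - Complex.I * (((t - t₀) * a j : ℝ) : ℂ)
    with hgdef
  -- The quotient is 1 at `t₀`, so near `t₀` it avoids the cut of the principal logarithm; hence the
  -- statement is only local.
  have hslit : ∀ᶠ t in nhds t₀, ∀ j, (c t₀ : Fin d → ℂ) j ≠ 0 →
      (c t : Fin d → ℂ) j / (c t₀ : Fin d → ℂ) j ∈ Complex.slitPlane := by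
    refine Filter.eventually_all.2 fun j => ?_
    by_cases hj : (c t₀ : Fin d → ℂ) j = 0
    · exact Filter.Eventually.of_forall fun t h => absurd hj h
    obtain ⟨k, -, hkj⟩ := hk t₀
    have hcont := ((hkj j).div_const ((c t₀ : Fin d → ℂ) j)).continuousAt
    have := hcont.eventually (Complex.isOpen_slitPlane.mem_nhds (by
      simp only [div_self hj]; exact Complex.one_mem_slitPlane))
    filter_upwards [this] with t ht _ using ht
  obtain ⟨ε, hε, hball⟩ := Metric.eventually_nhds_iff_ball.1 hslit
  have h₀ : t₀ ∈ Metric.ball t₀ ε := Metric.mem_ball_self hε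
  -- only the coordinates on the support of `c t₀` matter
  set g' : ℝ → Fin d → ℂ := fun t j => if (c t₀ : Fin d → ℂ) j = 0 then 0 else g t j with hg'
  have hmem : ∀ t ∈ Metric.ball t₀ ε, g' t ∈ P := by
    intro t ht
    refine mem_submodule_of_hasDerivAt P Metric.isOpen_ball
      (convex_ball t₀ ε).isPreconnected (g := g') (fun t ht => ?_) h₀ ?_ ht
    · obtain ⟨k, hk, hkj⟩ := hk t
      refine ⟨fun j => if (c t₀ : Fin d → ℂ) j = 0 then 0 else Complex.I * (k j : ℂ),
        ⟨k, hk, fun j hj => if_neg hj⟩, hasDerivAt_pi.2 fun j => ?_⟩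
      by_cases hj : (c t₀ : Fin d → ℂ) j = 0
      · simp only [hg', hj, if_true]
        exact hasDerivAt_const t 0
      · simp only [hg', hj, if_false]
        have hct : (c t : Fin d → ℂ) j ≠ 0 := by
          rw [← Complex.normSq_pos, hnorm t j, Complex.normSq_pos]
          exact hj
        have h1 := ((hkj j).div_const ((c t₀ : Fin d → ℂ) j)).clog_real (hball t ht j hj)
        have h2 : HasDerivAt (fun s : ℝ => Complex.I * (((s - t₀) * a j : ℝ) : ℂ))
            (Complex.I * ((1 * a j : ℝ) : ℂ)) t :=
          ((((hasDerivAt_id t).sub_const t₀).mul_const (a j)).ofReal_comp).const_mul Complex.I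
        refine (h1.sub h2).congr_deriv ?_
        field_simp
        push_cast
        ring
    · refine ⟨0, zero_mem _, fun j hj => ?_⟩
      simp [hg', hgdef, hj]
  filter_upwards [Metric.ball_mem_nhds t₀ hε] with t ht
  obtain ⟨k, hkk, hkj⟩ := hmem t ht
  refine ⟨fun i => ((k i : ℝ) : Angle), ?_, ?_⟩
  · rw [K, AddMonoidHom.mem_ker, betaTorus_coe, LinearMap.mem_ker.1 hkk]
    funext i
    simp
  · funext j
    rw [act_coe, act_oneParam]
    by_cases hj : (c t₀ : Fin d → ℂ) j = 0
    · have := hnorm t j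
      rw [hj, map_zero, Complex.normSq_eq_zero] at this
      simp [hj, this]
    · have h1 := hkj j hj
      simp only [hg', hj, if_false, hgdef] at h1
      have hct : (c t : Fin d → ℂ) j / (c t₀ : Fin d → ℂ) j ≠ 0 :=
        Complex.slitPlane_ne_zero (hball t ht j hj)
      rw [← mul_assoc, ← Complex.exp_add]
      have h2 : (k j : ℂ) * Complex.I + (((t - t₀) * a j : ℝ) : ℂ) * Complex.I =
          Complex.log ((c t : Fin d → ℂ) j / (c t₀ : Fin d → ℂ) j) := by
        linear_combination -h1
      rw [h2, Complex.exp_log hct, div_mul_cancel₀ _ hj]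

/-- The integral curves of the Reeb vector field are the projections of the orbits of the
one-parameter group generated by `a`. -/
theorem isReebTrajectory_iff {ν : Fin d → Fin (n + 1) → ℤ} {a : Fin d → ℝ} {γ : ℝ → N ν a} :
    IsReebTrajectory ν a γ ↔ ∃ z : S ν a, ∀ t, γ t = proj ν a (actS ν a (oneParam a t) z) := by
  constructor
  · rintro ⟨c, hγ, hc⟩
    refine ⟨c 0, fun t => ?_⟩
    -- Undoing the flow leaves a locally constant curve in `N`, which is constant since `ℝ` is
    -- connected.
    have hloc : IsLocallyConstant fun t => proj ν a (actS ν a (oneParam a (-t)) (c t)) := by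
      rw [IsLocallyConstant.iff_eventually_eq]
      intro t₀
      filter_upwards [eventually_exists_eq_act hc t₀] with t ht
      have h1 : proj ν a (actS ν a (oneParam a (t - t₀)) (c t₀)) = proj ν a (c t) :=
        proj_eq_iff.2 ht
      rw [← proj_actS_congr _ h1, ← actS_add, ← oneParam_add]
      congr 3
      ring
    have h := hloc.apply_eq_of_preconnectedSpace t 0
    simp only [neg_zero, oneParam_zero, actS_zero] at h
    rw [hγ, ← proj_actS_congr _ h, ← actS_add, ← oneParam_add, add_neg_cancel, oneParam_zero,
      actS_zero]
  · rintro ⟨z, hz⟩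
    refine ⟨fun t => actS ν a (oneParam a t) z, hz, fun t =>
      ⟨generator a (act (oneParam a t) z.1), ?_, isReebLift_generator (act_mem_S _ z.2)⟩⟩
    refine hasDerivAt_pi.2 fun j => ?_
    have e : ∀ s, (actS ν a (oneParam a s) z : Fin d → ℂ) j =
        Complex.exp (((s * a j : ℝ) : ℂ) * Complex.I) * z.1 j := fun s => act_oneParam _ _ _ _
    simp only [e]
    have h1 : HasDerivAt (fun s : ℝ => ((s * a j : ℝ) : ℂ) * Complex.I)
        (((1 * a j : ℝ) : ℂ) * Complex.I) t :=
      (((hasDerivAt_id t).mul_const (a j)).ofReal_comp).mul_const Complex.I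
    refine ((h1.cexp).mul_const (z.1 j)).congr_deriv ?_
    simp only [generator, act_oneParam]
    push_cast
    ring

/-! ### The moment map -/

/-- A vector annihilated by `ker β` comes from a point of `ℝ^(n+1)`. -/
theorem exists_ell_eq {ν : Fin d → Fin (n + 1) → ℤ} {q : Fin d → ℝ}
    (hq : ∀ k ∈ LinearMap.ker (beta ν), ∑ j, k j * q j = 0) : ∃ x, ∀ j, ell ν j x = q j := by
  let f : Module.Dual ℝ (Fin d → ℝ) :=
    { toFun := fun k => ∑ j, k j * q j
      map_add' := fun k l => by simp [add_mul, Finset.sum_add_distrib]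
      map_smul' := fun c k => by simp [Finset.mul_sum, mul_assoc] }
  -- The annihilator of `ker β` is the range of the transpose of `β`.
  have hf : f ∈ (beta ν).dualMap.range := by
    rw [LinearMap.range_dualMap_eq_dualAnnihilator_ker, Submodule.mem_dualAnnihilator]
    exact hq
  obtain ⟨g, hg⟩ := hf
  refine ⟨fun i => g (Pi.single i 1), fun j => ?_⟩
  have h1 : f (Pi.single j 1) = q j := by
    change ∑ i, (Pi.single j 1 : Fin d → ℝ) i * q i = q j
    rw [Finset.sum_eq_single j (fun i _ hi => by simp [Pi.single_eq_of_ne hi]) (by simp)]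
    simp
  have h2 := sum_mul_beta ν (Pi.single j 1) (fun i => g (Pi.single i 1))
  rw [Finset.sum_eq_single (s := Finset.univ) (f := fun i => (Pi.single j 1 : Fin d → ℝ) i * _) j
    (fun i _ hi => by simp [Pi.single_eq_of_ne hi]) (by simp), Pi.single_eq_same, one_mul] at h2
  rw [← h2, ← h1, ← hg, LinearMap.dualMap_apply]
  conv_rhs => rw [pi_eq_sum_univ' (beta ν (Pi.single j 1))]
  simp [mul_comm]

/-- `z` lies over the point `x` of the cone. -/
def LiesOver (ν : Fin d → Fin (n + 1) → ℤ) (x : Fin (n + 1) → ℝ) (z : Fin d → ℂ) : Prop :=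
  ∀ j, Complex.normSq (z j) = ell ν j x

theorem LiesOver.act {ν : Fin d → Fin (n + 1) → ℤ} {x : Fin (n + 1) → ℝ} {z : Fin d → ℂ}
    (h : LiesOver ν x z) (y : Torus d) : LiesOver ν x (act y z) := fun j => by
  rw [normSq_act, h j]

theorem LiesOver.mem_cone {ν : Fin d → Fin (n + 1) → ℤ} {x : Fin (n + 1) → ℝ} {z : Fin d → ℂ}
    (h : LiesOver ν x z) : x ∈ cone ν := fun j => by
  rw [← h j]
  exact Complex.normSq_nonneg _

theorem LiesOver.sum_eq_one {ν : Fin d → Fin (n + 1) → ℤ} {a : Fin d → ℝ} {x : Fin (n + 1) → ℝ}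
    {z : Fin d → ℂ} (h : LiesOver ν x z) (hz : z ∈ S ν a) : ∑ i, x i * beta ν a i = 1 := by
  rw [sum_mul_beta, ← (mem_S_iff.1 hz).2]
  exact Finset.sum_congr rfl fun j _ => by rw [h j]

theorem exists_liesOver {ν : Fin d → Fin (n + 1) → ℤ} {a : Fin d → ℝ} {x : Fin (n + 1) → ℝ}
    (hx : x ∈ cone ν) (h : ∑ i, x i * beta ν a i = 1) : ∃ z : S ν a, LiesOver ν x z.1 := by
  have hn : ∀ j, Complex.normSq ((√(ell ν j x) : ℝ) : ℂ) = ell ν j x := fun j => by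
    rw [Complex.normSq_ofReal, mul_self_sqrt (hx j)]
  refine ⟨⟨fun j => ((√(ell ν j x) : ℝ) : ℂ), mem_S_iff.2 ⟨fun k hk => ?_, ?_⟩⟩, hn⟩
  · simp only [hn]
    rw [← sum_mul_beta, LinearMap.mem_ker.1 hk]
    simp
  · simp only [hn]
    rw [← sum_mul_beta, h]

theorem LiesOver.exists_act_eq {ν : Fin d → Fin (n + 1) → ℤ} {x : Fin (n + 1) → ℝ}
    {z w : Fin d → ℂ} (hz : LiesOver ν x z) (hw : LiesOver ν x w) :
    ∃ r : Fin d → ℝ, ToricContact.act (fun i => ((r i : ℝ) : Angle)) z = w := by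
  -- Where `z_j = 0` the quotient is 0 by convention and the angle is irrelevant, since `w_j = 0`
  -- too.
  refine ⟨fun j => (w j / z j).arg, funext fun j => ?_⟩
  rw [act_coe]
  have h : Complex.normSq (w j) = Complex.normSq (z j) := by rw [hz j, hw j]
  by_cases hj : z j = 0
  · rw [hj, map_zero, Complex.normSq_eq_zero] at h
    simp [hj, h]
  · have hn : ‖w j / z j‖ = 1 := by
      rw [norm_div, Complex.norm_def, Complex.norm_def, h]
      exact div_self (by simpa [Complex.normSq_eq_norm_sq] using hj)
    have := Complex.norm_mul_exp_arg_mul_I (w j / z j)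
    rw [hn, Complex.ofReal_one, one_mul] at this
    rw [this, div_mul_cancel₀ _ hj]

theorem liesOver_of_proj_eq {ν : Fin d → Fin (n + 1) → ℤ} {a : Fin d → ℝ} {x : Fin (n + 1) → ℝ}
    {z w : S ν a} (hz : LiesOver ν x z.1) (h : proj ν a z = proj ν a w) : LiesOver ν x w.1 := by
  obtain ⟨y, -, hy⟩ := proj_eq_iff.1 h
  rw [← hy]
  exact hz.act y

/-! ### Closed orbits -/

/-- The set of points of `N` over the point `x` of the cone. -/
def fiber (ν : Fin d → Fin (n + 1) → ℤ) (a : Fin d → ℝ) (x : Fin (n + 1) → ℝ) : Set (N ν a) :=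
  proj ν a '' {z | LiesOver ν x z.1}

/-- Some `y ∈ K` undoes the flow at time `T`, so `y_j = -T a_j` wherever `z_j ≠ 0`. Pairing `β(y) =
0` with `m` removes the remaining coordinates, because `ℓ_j(m) = 0` there, and leaves `-T⟨m, ν⟩ = 0`
modulo `2π`. -/
theorem exists_int_of_period {ν : Fin d → Fin (n + 1) → ℤ} {a : Fin d → ℝ}
    {x : Fin (n + 1) → ℝ} {z : S ν a} (hz : LiesOver ν x z.1) {T : ℝ}
    (hT : proj ν a (actS ν a (oneParam a T) z) = proj ν a z) (m : Fin (n + 1) → ℤ)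
    (hm : InFaceSpan ν x (intVec m)) : ∃ p : ℤ, T * ∑ i, (m i : ℝ) * beta ν a i = 2 * π * p := by
  obtain ⟨y, hy, h⟩ := proj_eq_iff.1 hT
  have hsupp : ∀ j, z.1 j ≠ 0 → y j = -((T * a j : ℝ) : Angle) := by
    intro j hj
    have h1 : ((y j + ((T * a j : ℝ) : Angle)).toCircle : ℂ) = 1 := by
      have := congrFun h j
      simp only [actS, act, oneParam] at this
      rw [Angle.toCircle_add, Circle.coe_mul]
      apply mul_right_cancel₀ hj
      rw [mul_assoc, this, one_mul]
    have h2 : (y j + ((T * a j : ℝ) : Angle)).toCircle = (0 : Angle).toCircle := by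
      rw [Angle.toCircle_zero]
      exact Circle.ext h1
    have h3 := congrArg (fun u : Circle => ((Complex.arg u : ℝ) : Angle)) h2
    simp only [Angle.arg_toCircle] at h3
    exact eq_neg_of_add_eq_zero_left h3
  have h0 : ∑ j, (∑ i, m i * ν j i) • y j = 0 := by
    have : ∑ i, m i • betaTorus ν y i = 0 := by
      rw [AddMonoidHom.mem_ker.1 hy]
      simp
    rw [← this]
    simp only [betaTorus, AddMonoidHom.coe_mk, ZeroHom.coe_mk, Finset.smul_sum, Finset.sum_smul,
      mul_smul]
    exact Finset.sum_comm
  have h1 : ∑ j, (∑ i, m i * ν j i) • y j =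
      -((T * ∑ i, (m i : ℝ) * beta ν a i : ℝ) : Angle) := by
    have e : T * ∑ i, (m i : ℝ) * beta ν a i =
        ∑ j, T * (a j * ((∑ i, m i * ν j i : ℤ) : ℝ)) := by
      rw [← Finset.mul_sum]
      congr 1
      refine (sum_mul_beta ν a (intVec m)).trans (Finset.sum_congr rfl fun j _ => ?_)
      rw [ell_intVec]
    rw [e, ← Angle.coe_coeHom, map_sum, ← Finset.sum_neg_distrib]
    refine Finset.sum_congr rfl fun j _ => ?_
    by_cases hj : z.1 j = 0
    · have : ell ν j x = 0 := by rw [← hz j, hj, map_zero]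
      have := hm j this
      rw [ell_intVec, Int.cast_eq_zero] at this
      rw [this]
      simp
    · rw [hsupp j hj, smul_neg, ← Angle.coe_coeHom, ← map_zsmul, zsmul_eq_mul]
      congr 2
      ring
  rw [h1, neg_eq_zero, Angle.coe_eq_zero_iff] at h0
  obtain ⟨p, hp⟩ := h0
  exact ⟨p, by rw [← hp, zsmul_eq_mul, mul_comm]⟩

/-- By orthogonality to `x`, `β(r) - 2πu = β(c)` with `c` supported on the coordinates where `z`
vanishes. So `r - c` defines an element of `K` that acts on `z` as `r` does. -/
theorem proj_act_eq_self {ν : Fin d → Fin (n + 1) → ℤ} {a : Fin d → ℝ} {x : Fin (n + 1) → ℝ}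
    {z : S ν a} (hz : LiesOver ν x z.1) (hx : ∀ y, InFaceSpan ν x y → ∃ c : ℝ, y = c • x)
    (r : Fin d → ℝ) (u : Fin (n + 1) → ℤ) (h : ∑ i, x i * (beta ν r i - 2 * π * u i) = 0) :
    proj ν a (actS ν a (fun i => ((r i : ℝ) : Angle)) z) = proj ν a z := by
  obtain ⟨c, hc, hcβ⟩ := exists_beta_eq_of_line hx h
  have hK : (fun i => (((r - c) i : ℝ) : Angle)) ∈ K ν := by
    rw [K, AddMonoidHom.mem_ker, betaTorus_coe, map_sub, hcβ]
    funext i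
    simp only [Pi.sub_apply, sub_sub_cancel]
    rw [Pi.zero_apply, Angle.coe_eq_zero_iff]
    exact ⟨u i, by rw [zsmul_eq_mul, mul_comm]⟩
  refine (proj_eq_iff.2 ⟨_, hK, funext fun j => ?_⟩).symm
  change _ = act (fun i => ((r i : ℝ) : Angle)) z.1 j
  rw [act_coe, act_coe]
  by_cases hj : z.1 j = 0
  · simp [hj]
  · have : c j = 0 := hc j (by rw [← hz j]; simpa using hj)
    simp [this]

/-- The Reeb flow is transitive on the points over a point of an edge. -/
theorem fiber_eq_range {ν : Fin d → Fin (n + 1) → ℤ} {a : Fin d → ℝ} {x : Fin (n + 1) → ℝ}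
    (hx : x ∈ edgePoints ν (beta ν a)) {z : S ν a} (hz : LiesOver ν x z.1) :
    fiber ν a x = Set.range fun t => proj ν a (actS ν a (oneParam a t) z) := by
  ext q
  constructor
  · rintro ⟨w, hw, rfl⟩
    obtain ⟨r, hr⟩ := hz.exists_act_eq hw
    -- Since `⟨x, β(a)⟩ = 1`, this is the time for which `β(r - t a)` is orthogonal to `x`.
    set t := ∑ i, x i * beta ν r i with ht
    refine ⟨t, ?_⟩
    have h := proj_act_eq_self hz hx.2.2 (r - t • a) 0 (by
      simp only [map_sub, map_smul, Pi.sub_apply, Pi.smul_apply, smul_eq_mul, Pi.zero_apply,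
        Int.cast_zero, mul_zero, sub_zero, mul_sub, Finset.sum_sub_distrib]
      rw [← ht, sub_eq_zero]
      conv_lhs => rw [← mul_one t, ← hx.2.1, Finset.mul_sum]
      exact Finset.sum_congr rfl fun i _ => mul_left_comm _ _ _)
    dsimp only
    rw [← proj_actS_congr (oneParam a t) h, ← actS_add]
    congr 1
    refine Subtype.ext (Eq.trans ?_ hr)
    change act _ z.1 = _
    congr 1
    funext i
    simp [oneParam]
  · rintro ⟨t, rfl⟩
    exact ⟨_, hz.act _, rfl⟩

/-- A point of the fibre recovers all `ℓ_j(x) = |z_j|²`, and these determine `x` because the normals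
span. -/
theorem injOn_fiber {ν : Fin d → Fin (n + 1) → ℤ} {a : Fin d → ℝ}
    (hdense : DenseRange (oneParam (beta ν a))) :
    Set.InjOn (fiber ν a) (edgePoints ν (beta ν a)) := by
  intro x hx y hy hxy
  obtain ⟨z, hz⟩ := exists_liesOver hx.1 hx.2.1
  have hmem : proj ν a z ∈ fiber ν a y := by
    rw [← hxy]
    exact ⟨z, hz, rfl⟩
  obtain ⟨w, hw, hwz⟩ := hmem
  have hzy := liesOver_of_proj_eq hw hwz
  refine sub_eq_zero.1 (eq_zero_of_ell_eq_zero hdense fun j => ?_)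
  rw [sub_eq_add_neg, ← neg_one_smul ℝ y, ell_add, ell_smul, ← hz j, ← hzy j]
  ring

/-- The periods of the Reeb orbit through `[z]`. -/
def periods (ν : Fin d → Fin (n + 1) → ℤ) (a : Fin d → ℝ) (z : S ν a) : AddSubgroup ℝ where
  carrier := {t | proj ν a (actS ν a (oneParam a t) z) = proj ν a z}
  zero_mem' := by
    change proj ν a _ = _
    rw [oneParam_zero, actS_zero]
  add_mem' {s t} hs ht := by
    change proj ν a _ = _
    rw [oneParam_add, actS_add, proj_actS_congr _ ht]
    exact hs
  neg_mem' {t} ht := by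
    change proj ν a _ = _
    rw [← proj_actS_congr _ ht, ← actS_add, ← oneParam_add, neg_add_cancel, oneParam_zero,
      actS_zero]

theorem mem_periods {ν : Fin d → Fin (n + 1) → ℤ} {a : Fin d → ℝ} {z : S ν a} {t : ℝ} :
    t ∈ periods ν a z ↔ proj ν a (actS ν a (oneParam a t) z) = proj ν a z := Iff.rfl

theorem sub_mem_periods_iff {ν : Fin d → Fin (n + 1) → ℤ} {a : Fin d → ℝ} {z : S ν a}
    {s t : ℝ} : t - s ∈ periods ν a z ↔
      proj ν a (actS ν a (oneParam a t) z) = proj ν a (actS ν a (oneParam a s) z) := by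
  rw [mem_periods]
  constructor
  · intro h
    rw [← proj_actS_congr (oneParam a s) h, ← actS_add, ← oneParam_add, add_sub_cancel]
  · intro h
    have := proj_actS_congr (oneParam a (-s)) h
    rwa [← actS_add, ← actS_add, ← oneParam_add, ← oneParam_add, neg_add_cancel, oneParam_zero,
      actS_zero, neg_add_eq_sub] at this

/-- The line of `x` contains an integral `m = c x` with `⟨m, ν⟩ = c ≠ 0`. This provides a nonzero
period, and it forces `t c ∈ 2πℤ` for every period `t`, so none lies strictly between 0 and
`2π/|c|`. -/
theorem exists_isLeast_period {ν : Fin d → Fin (n + 1) → ℤ} {a : Fin d → ℝ}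
    {x : Fin (n + 1) → ℝ} (hx : x ∈ edgePoints ν (beta ν a)) {z : S ν a}
    (hz : LiesOver ν x z.1) : ∃ T, IsLeast {t | t ∈ periods ν a z ∧ 0 < t} T := by
  have hx0 := ne_zero_of_mem_edgePoints hx
  obtain ⟨m, c, hc, hm⟩ := exists_intVec_of_line hx0 hx.2.2
  have hmi : ∀ i, (m i : ℝ) = c * x i := fun i => congrFun hm i
  have hsum : ∑ i, (m i : ℝ) * beta ν a i = c := by
    simp only [hmi, mul_assoc]
    rw [← Finset.mul_sum, hx.2.1, mul_one]
  -- With `T = 2πc|x|²` and `⟨x, ν⟩ = 1`, the vector `Tν - 2πm` is orthogonal to `x`.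
  have hT : 2 * π * c * ∑ i, x i * x i ∈ periods ν a z := by
    refine proj_act_eq_self hz hx.2.2 (fun j => (2 * π * c * ∑ i, x i * x i) * a j) m ?_
    have : (fun j => (2 * π * c * ∑ i, x i * x i) * a j) =
      (2 * π * c * ∑ i, x i * x i) • a := rfl
    rw [this, map_smul]
    simp only [Pi.smul_apply, smul_eq_mul, mul_sub, Finset.sum_sub_distrib]
    simp only [mul_left_comm (x _) (2 * π * c * _)]
    rw [← Finset.mul_sum, hx.2.1, mul_one, Finset.mul_sum, ← Finset.sum_sub_distrib]
    refine Finset.sum_eq_zero fun i _ => ?_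
    rw [hmi]
    ring
  have hxx : ∑ i, x i * x i ≠ 0 := by
    intro h
    apply hx0
    funext i
    have := (Finset.sum_eq_zero_iff_of_nonneg (fun i _ => mul_self_nonneg (x i))).1 h i
      (Finset.mem_univ i)
    exact mul_self_eq_zero.1 this
  refine AddSubgroup.exists_isLeast_pos (a := 2 * π / |c|) (fun hbot => ?_)
    (div_pos two_pi_pos (abs_pos.2 hc)) (Set.disjoint_left.2 fun t ht htI => ?_)
  · rw [hbot, AddSubgroup.mem_bot] at hT
    exact mul_ne_zero (mul_ne_zero two_pi_pos.ne' hc) hxx hT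
  · obtain ⟨p, hp⟩ := exists_int_of_period hz ht m fun j hj => by
      rw [hm, ell_smul, hj, mul_zero]
    rw [hsum] at hp
    have h1 : t * |c| = 2 * π * |(p : ℝ)| := by
      rw [← abs_of_pos htI.1, ← abs_mul, hp, abs_mul, abs_of_pos two_pi_pos]
    have h2 : t * |c| < 2 * π := (lt_div_iff₀ (abs_pos.2 hc)).1 htI.2
    have h3 : |(p : ℝ)| < 1 := by
      rw [h1] at h2
      nlinarith [two_pi_pos]
    have h4 : p = 0 := by
      rw [← Int.cast_abs] at h3
      exact Int.abs_lt_one_iff.1 (by exact_mod_cast h3)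
    rw [h4] at hp
    simp only [Int.cast_zero, mul_zero, mul_eq_zero] at hp
    exact hp.elim htI.1.ne' hc

/-- The simple closed Reeb orbits are the preimages of the edges. -/
theorem image_fiber {ν : Fin d → Fin (n + 1) → ℤ} {a : Fin d → ℝ}
    (hdense : DenseRange (oneParam (beta ν a))) :
    fiber ν a '' edgePoints ν (beta ν a) = simpleClosedReebOrbits ν a := by
  ext O
  constructor
  · rintro ⟨x, hx, rfl⟩
    obtain ⟨z, hz⟩ := exists_liesOver hx.1 hx.2.1
    obtain ⟨T, ⟨hT, hT0⟩, hmin⟩ := exists_isLeast_period hx hz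
    -- A coincidence at times `s < t` in `[0, T)` would make `t - s` a positive period smaller than
    -- `T`.
    have hinj : ∀ s t : ℝ, 0 ≤ s → t < T → s ≤ t →
        proj ν a (actS ν a (oneParam a s) z) = proj ν a (actS ν a (oneParam a t) z) → s = t := by
      intro s t hs ht hst h
      by_contra hne
      have := hmin ⟨sub_mem_periods_iff.2 h.symm, sub_pos.2 (lt_of_le_of_ne hst hne)⟩
      linarith
    refine ⟨fun t => proj ν a (actS ν a (oneParam a t) z), T,
      isReebTrajectory_iff.2 ⟨z, fun t => rfl⟩, hT0, fun t => ?_, ?_, fiber_eq_range hx hz⟩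
    · exact sub_mem_periods_iff.1 (by rwa [add_sub_cancel_left])
    · intro s hs t ht h
      rcases le_total s t with hst | hst
      · exact hinj s t hs.1 ht.2 hst h
      · exact (hinj t s ht.1 hs.2 hst h.symm).symm
  · rintro ⟨γ, T, hγ, hT, hper, -, rfl⟩
    obtain ⟨z, hz⟩ := isReebTrajectory_iff.1 hγ
    obtain ⟨x, hx⟩ := exists_ell_eq (mem_S_iff.1 z.2).1
    have hover : LiesOver ν x z.1 := fun j => (hx j).symm
    have hx1 := hover.sum_eq_one z.2
    have hx0 : x ≠ 0 := by
      rintro rfl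
      simp at hx1
    have hperiod : proj ν a (actS ν a (oneParam a T) z) = proj ν a z := by
      have := hper 0
      rwa [zero_add, hz, hz, oneParam_zero, actS_zero] at this
    have hmem : x ∈ edgePoints ν (beta ν a) := ⟨hover.mem_cone, hx1,
      inFaceSpan_subset_line hdense hx0 hT.ne' (exists_int_of_period hover hperiod)⟩
    exact ⟨x, hmem, (fiber_eq_range hmem hover).trans (congrArg Set.range (funext hz).symm)⟩

end ToricContact

theorem mainTheorem6 (n d : ℕ) (ν : Fin d → Fin (n + 1) → ℤ)
    (hν : ToricContact.IsGoodCone ν)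
    (a : Fin d → ℝ) (ha : ∀ j, 0 < a j)
    (hdense : DenseRange (ToricContact.oneParam (ToricContact.beta ν a))) :
    (ToricContact.edges (ToricContact.cone ν)).Finite ∧
      (ToricContact.simpleClosedReebOrbits ν a).Finite ∧
      (ToricContact.simpleClosedReebOrbits ν a).ncard =
        (ToricContact.edges (ToricContact.cone ν)).ncard := by
  have hfin := ToricContact.edgePoints_finite ν (ToricContact.beta ν a)
  rw [← ToricContact.image_faceOf ha hdense, ← ToricContact.image_fiber hdense]
  refine ⟨hfin.image _, hfin.image _, ?_⟩
  rw [(ToricContact.injOn_fiber hdense).ncard_image,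
    (ToricContact.injOn_faceOf ν _).ncard_image]
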